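/- For $f,g\in \mathrm{PSL}(2,\mathbb C)$ put $\gamma(f,g)=\operatorname{tr}[f,g]-2$, where $[f,g]=fgf^{-1}g^{-1}$ is computed with any matrix representatives in $\mathrm{SL}(2,\mathbb C)$. A subgroup of $\mathrm{PSL}(2,\mathbb C)$ is called an arithmetic Kleinian group if it is commensurable with $P\rho(\mathcal O^1)$, where $\mathcal O$ is an order in a quaternion algebra $A$ over a number field $k$ with exactly one complex place, $A$ is ramified at all real places of $k$, $\mathcal O^1$ is the group of elements of $\mathcal O$ of reduced norm $1$, and $\rho:A\to M_2(\mathbb C)$ is a ring embedding that extends a non-real embedding $k\to\mathbb C$. Theorem. Let $f,g\in\mathrm{PSL}(2,\mathbb C)$ be two elements of order $4$ such that $\langle f,g\rangle$ is discrete and contained in an arithmetic Kleinian group, and suppose that $\gamma=\gamma(f,g)$ is not real. Let $\tilde\gamma\in\mathbb C$ be any number with $\tilde\gamma(\tilde\gamma+2)=\gamma$. Then there is $\Phi\in\mathrm{PSL}(2,\mathbb C)$ of order $2$ such that $\Phi f\Phi^{-1}=g$ or $\Phi f\Phi^{-1}=g^{-1}$, such that $\gamma(f,\Phi)=\tilde\gamma$,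 and such that $\langle f,\Phi\rangle$ is discrete and contained in an arithmetic Kleinian group. -/

import Mathlib

open scoped MatrixGroups Quaternion NumberField TensorProduct

namespace Kleinian

/-- `tr [A, B] - 2` for matrices `A, B` in `SL(2, ℂ)`, where `[A, B] = A B A⁻¹ B⁻¹`. -/
noncomputable def slGamma (A B : SL(2, ℂ)) : ℂ :=
  Matrix.trace ((A * B * A⁻¹ * B⁻¹ : SL(2, ℂ)) : Matrix (Fin 2) (Fin 2) ℂ) - 2

theorem slGamma_mul_center (A B z w : SL(2, ℂ))
    (hz : z ∈ Subgroup.center SL(2, ℂ)) (hw : w ∈ Subgroup.center SL(2, ℂ)) :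
    slGamma (A * z) (B * w) = slGamma A B := by
  have hz' := Subgroup.mem_center_iff.1 hz
  have hw' := Subgroup.mem_center_iff.1 hw
  have h1 : A * z * (B * w) = A * B * (z * w) := by
    rw [mul_assoc, ← mul_assoc z B w, ← hz' B]
    simp only [mul_assoc]
  have h2 : B * w * (A * z) = B * A * (z * w) := by
    rw [mul_assoc, ← mul_assoc w A z, ← hw' A, hw' z]
    simp only [mul_assoc]
  have h3 : ∀ x y : SL(2, ℂ), x * y * x⁻¹ * y⁻¹ = (x * y) * (y * x)⁻¹ := by
    intro x y
    simp [mul_assoc]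
  have h : A * z * (B * w) * (A * z)⁻¹ * (B * w)⁻¹ = A * B * A⁻¹ * B⁻¹ := by
    rw [h3, h3, h1, h2]
    group
  simp only [slGamma, h]

/-- The commutator parameter `γ(f, g) = tr [f, g] - 2` of two elements of `PSL(2, ℂ)`, computed
with arbitrary matrix representatives. -/
noncomputable def gamma (f g : PSL(2, ℂ)) : ℂ :=
  Quotient.liftOn₂ f g slGamma (by
    intro A B A' B' hA hB
    have hA' := QuotientGroup.leftRel_apply.1 hA
    have hB' := QuotientGroup.leftRel_apply.1 hB
    have h := slGamma_mul_center A B _ _ hA' hB'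
    simpa using h.symm)

/-- A subgroup of `PSL(2, ℂ)` is discrete if its subspace topology is discrete; `PSL(2, ℂ)` has the
quotient topology from `SL(2, ℂ)`. -/
def IsDiscrete (H : Subgroup PSL(2, ℂ)) : Prop :=
  DiscreteTopology H

/-- The quaternion algebra with `i² = a`, `j² = b` over `k` is ramified at the real embedding `τ`:
after base change along `τ` it becomes Hamilton's quaternions. -/
def IsRamifiedAtReal {k : Type} [Field k] (a b : k) (τ : k →+* ℝ) : Prop :=
  letI := τ.toAlgebra
  Nonempty ((ℝ ⊗[k] ℍ[k, a, b]) ≃ₐ[ℝ] ℍ[ℝ])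

/-- Orders in a quaternion algebra over a number field `k`: subrings containing the ring of integers
`𝓞 k` that are finitely generated over `𝓞 k` and span the algebra over `k`. -/
def IsOrder {k : Type} [Field k] [NumberField k] {a b : k}
    (O : Subalgebra (𝓞 k) ℍ[k, a, b]) : Prop :=
  (Subalgebra.toSubmodule O).FG ∧ Submodule.span k (O : Set ℍ[k, a, b]) = ⊤

/-- The image `ρ(O¹)` in `SL(2, ℂ)` of the units of reduced norm `x * star x = 1` of an order `O`. -/
def normOneImage {k : Type} [Field k] [NumberField k] {a b : k}
    (O : Subalgebra (𝓞 k) ℍ[k, a, b])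
    (ρ : ℍ[k, a, b] →+* Matrix (Fin 2) (Fin 2) ℂ) : Subgroup SL(2, ℂ) where
  carrier := {M | ∃ u : Oˣ, ((u : O) : ℍ[k, a, b]) * star ((u : O) : ℍ[k, a, b]) = 1 ∧
    ρ ((u : O) : ℍ[k, a, b]) = (M : Matrix (Fin 2) (Fin 2) ℂ)}
  one_mem' := ⟨1, by simp, by simp⟩
  mul_mem' := by
    rintro M N ⟨u, hu, hM⟩ ⟨v, hv, hN⟩
    refine ⟨u * v, ?_, by simp [hM, hN]⟩
    simp only [Units.val_mul, MulMemClass.coe_mul, star_mul]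
    rw [mul_assoc, ← mul_assoc (((v : O) : ℍ[k, a, b])), hv, one_mul, hu]
  inv_mem' := by
    rintro M ⟨u, hu, hM⟩
    have h1 : (((u⁻¹ : Oˣ) : O) : ℍ[k, a, b]) * ((u : O) : ℍ[k, a, b]) = 1 := by
      rw [← MulMemClass.coe_mul, Units.inv_mul, OneMemClass.coe_one]
    have h2 : star ((u : O) : ℍ[k, a, b]) = (((u⁻¹ : Oˣ) : O) : ℍ[k, a, b]) := by
      calc star ((u : O) : ℍ[k, a, b])
          = (((u⁻¹ : Oˣ) : O) : ℍ[k, a, b]) * ((u : O) : ℍ[k, a, b])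
              * star ((u : O) : ℍ[k, a, b]) := by rw [h1, one_mul]
        _ = (((u⁻¹ : Oˣ) : O) : ℍ[k, a, b]) := by rw [mul_assoc, hu, mul_one]
    refine ⟨u⁻¹, by rw [← h2, star_star, h2, h1], ?_⟩
    have h3 : ρ (((u⁻¹ : Oˣ) : O) : ℍ[k, a, b]) * (M : Matrix (Fin 2) (Fin 2) ℂ) = 1 := by
      rw [← hM, ← map_mul, h1, map_one]
    have h4 : (M : Matrix (Fin 2) (Fin 2) ℂ) * ((M⁻¹ : SL(2, ℂ)) : Matrix (Fin 2) (Fin 2) ℂ) = 1 := by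
      rw [← Matrix.SpecialLinearGroup.coe_mul, mul_inv_cancel, Matrix.SpecialLinearGroup.coe_one]
    exact left_inv_eq_right_inv h3 h4

/-- Arithmetic Kleinian groups: subgroups of `PSL(2, ℂ)` commensurable with some `Pρ(O¹)`, where `k` is
a number field with exactly one complex place, `O` is an order in a quaternion algebra over `k` that is
ramified at all real places of `k`, and `ρ` is an embedding of the algebra in the complex 2 by 2
matrices which extends a non-real embedding `σ` of `k` in `ℂ`. -/
def IsArithmeticKleinian (Γ : Subgroup PSL(2, ℂ)) : Prop :=
  ∃ (k : Type) (_ : Field k) (_ : NumberField k) (a b : k) (σ : k →+* ℂ)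
    (ρ : ℍ[k, a, b] →+* Matrix (Fin 2) (Fin 2) ℂ) (O : Subalgebra (𝓞 k) ℍ[k, a, b]),
    NumberField.InfinitePlace.nrComplexPlaces k = 1 ∧
    a ≠ 0 ∧ b ≠ 0 ∧
    (∀ τ : k →+* ℝ, IsRamifiedAtReal a b τ) ∧
    ¬ NumberField.ComplexEmbedding.IsReal σ ∧
    (∀ c : k, ρ (algebraMap k ℍ[k, a, b] c) = Matrix.scalar (Fin 2) (σ c)) ∧
    IsOrder O ∧
    Subgroup.Commensurable Γ
      ((normOneImage O ρ).map (QuotientGroup.mk' (Subgroup.center SL(2, ℂ))))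

end Kleinian

/-! Lift `f` and `g` to `(τ/2)(1 + I)` and `(τ'/2)(1 + J)` with `I² = J² = -1` and `τ² = τ'² = 2`,
and put `t = tr(IJ)/2`, so that `IJ + JI = 2t` and `γ = t² - 1`. The two roots `γ̃` are then `-1 -
t` and `-1 + t`. Since `(I + J) I = J (I + J)`, the involution `Φ` given by `I + J` conjugates `f`
to `g`, and it has `γ(f, Φ) = -1 - t`. Replacing `J` by `-J`, that is `g` by `g⁻¹`, gives the other
root. As `Φ` swaps `f` and `g`, it normalises `⟨f, g⟩`, and discreteness passes to the finite
extension (`isDiscrete_closure`).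

Arithmeticity is the substantial part (`exists_isArithmeticKleinian`). A fixed power `n` sends all
of `⟨f, g⟩` into `Pρ(O¹)`. Because `γ` is not real, no positive power of the lift of `fg` is scalar,
and its `n`-th power together with conjugates by `f` and `f²` forces `I`, and likewise `J`, to come
from elements `i`, `j` of the quaternion algebra itself (`exists_map_eq`). Moreover `t` is an
algebraic integer, as `±(1 + t)` is the trace of the lift of `fg` (`isIntegral_trace_mul_div_two`).

Hence `1, i, j, (1 + i)(1 + j)/2` span an order (`isOrder_combOrder`). It is normalised by both `f`
and `Φ`, and its norm one group contains `fg`. Adjoining `f` and `Φ` to that group is therefore a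
finite extension (`commensurable_sup_zpowers`), which is the required arithmetic group. -/

namespace Subgroup

/-! ### Normalisers and elements of finite order. -/

variable {G : Type*} [Group G]

theorem mem_normalizer_of_isOfFinOrder {K : Subgroup G} {x : G} (hx : IsOfFinOrder x)
    (h : ∀ y ∈ K, x * y * x⁻¹ ∈ K) : x ∈ normalizer (K : Set G) := by
  have hpow : ∀ n : ℕ, ∀ y ∈ K, x ^ n * y * (x ^ n)⁻¹ ∈ K := by
    intro n
    induction n with
    | zero => intro y hy; simpa using hy
    | succ n ih =>
      intro y hy
      have := h _ (ih y hy)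
      rwa [show x * (x ^ n * y * (x ^ n)⁻¹) * x⁻¹ = x ^ (n + 1) * y * (x ^ (n + 1))⁻¹ by
        rw [pow_succ']; group] at this
  -- Finite order makes `x⁻¹` a nonnegative power of `x`, so one inclusion suffices.
  obtain ⟨n, hn⟩ := hx.mem_powers_iff_mem_zpowers.2 (inv_mem (mem_zpowers x))
  rw [mem_normalizer_iff]
  refine fun y => ⟨h y, fun hy => ?_⟩
  have := hpow n _ hy
  dsimp only at hn
  rw [hn] at this
  simpa [mul_assoc] using this

/-- By the second isomorphism theorem the index is that of a subgroup of the finite group `⟨x⟩`. -/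
theorem relIndex_sup_zpowers_ne_zero {K : Subgroup G} {x : G} (hx : IsOfFinOrder x)
    (h : x ∈ normalizer (K : Set G)) : K.relIndex (K ⊔ zpowers x) ≠ 0 := by
  have hK : K ≤ normalizer (K : Set G) := le_normalizer
  have hz : zpowers x ≤ normalizer (K : Set G) := by simpa using h
  rw [← relIndex_subgroupOf (sup_le hK hz), subgroupOf_sup hK hz, relIndex_sup_left,
    relIndex_subgroupOf hz]
  have : Finite (zpowers x) := hx.finite_zpowers
  exact index_ne_zero_of_finite

end Subgroup

namespace Kleinian

/-! ### Discreteness in `PSL(2, ℂ)`. -/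

theorem isClosed_center : IsClosed (Subgroup.center SL(2, ℂ) : Set SL(2, ℂ)) := by
  have : (Subgroup.center SL(2, ℂ) : Set SL(2, ℂ)) = ⋂ B : SL(2, ℂ), {A | B * A = A * B} := by
    ext A
    simp [Subgroup.mem_center_iff]
  rw [this]
  exact isClosed_iInter fun B => isClosed_eq (by fun_prop) (by fun_prop)

instance : T2Space PSL(2, ℂ) := by
  have := isClosed_center
  have : T3Space (SL(2, ℂ) ⧸ Subgroup.center SL(2, ℂ)) :=
    QuotientGroup.instT3Space (Subgroup.center SL(2, ℂ))
  exact inferInstanceAs (T2Space (SL(2, ℂ) ⧸ Subgroup.center SL(2, ℂ)))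

theorem IsDiscrete.of_le {H K : Subgroup PSL(2, ℂ)} (hK : IsDiscrete K) (h : H ≤ K) :
    IsDiscrete H := by
  have : DiscreteTopology (K : Set PSL(2, ℂ)) := hK
  exact DiscreteTopology.of_subset this h

/-- Discreteness passes up a finite-index inclusion because `PSL(2, ℂ)` is Hausdorff. -/
theorem IsDiscrete.sup_zpowers {H : Subgroup PSL(2, ℂ)} (hH : IsDiscrete H) {x : PSL(2, ℂ)}
    (hx : IsOfFinOrder x) (h : x ∈ Subgroup.normalizer (H : Set PSL(2, ℂ))) :
    IsDiscrete (H ⊔ Subgroup.zpowers x) :=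
  have : H.IsFiniteRelIndex (H ⊔ Subgroup.zpowers x) :=
    ⟨Subgroup.relIndex_sup_zpowers_ne_zero hx h⟩
  (Subgroup.discreteTopology_iff_of_isFiniteRelIndex le_sup_left).1 hH

/-! ### Lifts to `SL(2, ℂ)` and elements of order four. -/

/-- The projection from `SL(2, ℂ)` onto `PSL(2, ℂ)`. -/
abbrev proj : SL(2, ℂ) →* PSL(2, ℂ) := QuotientGroup.mk' (Subgroup.center SL(2, ℂ))

theorem proj_surjective : Function.Surjective proj := QuotientGroup.mk'_surjective _

theorem proj_eq_one_iff {A : SL(2, ℂ)} : proj A = 1 ↔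
    (A : Matrix (Fin 2) (Fin 2) ℂ) = 1 ∨ (A : Matrix (Fin 2) (Fin 2) ℂ) = -1 := by
  rw [QuotientGroup.mk'_apply, QuotientGroup.eq_one_iff, Matrix.SpecialLinearGroup.mem_center_iff]
  constructor
  · rintro ⟨r, hr, h⟩
    rw [Fintype.card_fin, pow_two, mul_self_eq_one_iff] at hr
    rcases hr with rfl | rfl
    · exact .inl (by rw [← h, map_one])
    · exact .inr (by rw [← h, map_neg, map_one])
  · rintro (h | h)
    · exact ⟨1, by simp, by simp [h]⟩
    · exact ⟨-1, by simp, by rw [h, map_neg, map_one]⟩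

theorem gamma_proj (A B : SL(2, ℂ)) : gamma (proj A) (proj B) = slGamma A B := rfl

/-- `det(AB - BA) = det([A, B] - 1) = 2 - tr[A, B]`. In this form, adding scalars to `A` or `B` has
no effect, so only `IJ - JI` matters. -/
theorem slGamma_eq_neg_det (A B : SL(2, ℂ)) : slGamma A B =
    -((A : Matrix (Fin 2) (Fin 2) ℂ) * B - (B : Matrix (Fin 2) (Fin 2) ℂ) * A).det := by
  have hA := A.det_coe
  have hB := B.det_coe
  rw [Matrix.det_fin_two] at hA hB
  simp only [slGamma, Matrix.SpecialLinearGroup.coe_mul, Matrix.SpecialLinearGroup.coe_inv,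
    Matrix.adjugate_fin_two, Matrix.trace_fin_two, Matrix.det_fin_two, Matrix.mul_apply,
    Fin.sum_univ_two, Matrix.sub_apply, Matrix.of_apply, Matrix.cons_val', Matrix.cons_val_zero,
    Matrix.cons_val_one, Matrix.cons_val_fin_one]
  generalize (A : Matrix (Fin 2) (Fin 2) ℂ) 0 0 = a at *
  generalize (A : Matrix (Fin 2) (Fin 2) ℂ) 0 1 = b at *
  generalize (A : Matrix (Fin 2) (Fin 2) ℂ) 1 0 = c at *
  generalize (A : Matrix (Fin 2) (Fin 2) ℂ) 1 1 = d at *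
  generalize (B : Matrix (Fin 2) (Fin 2) ℂ) 0 0 = x at *
  generalize (B : Matrix (Fin 2) (Fin 2) ℂ) 0 1 = y at *
  generalize (B : Matrix (Fin 2) (Fin 2) ℂ) 1 0 = z at *
  generalize (B : Matrix (Fin 2) (Fin 2) ℂ) 1 1 = w at *
  linear_combination 2 * hA * (x * w - y * z) + 2 * hB

/-- A lift of an element of order four is, up to a factor `τ / 2` with `τ² = 2`, of the form `1 + I`
with `I² = -1`. -/
theorem exists_sqrt_neg_one (A : SL(2, ℂ)) (hA : orderOf (proj A) = 4) :
    ∃ (τ : ℂ) (I : Matrix (Fin 2) (Fin 2) ℂ), τ ^ 2 = 2 ∧ I * I = -1 ∧ I.trace = 0 ∧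
      (A : Matrix (Fin 2) (Fin 2) ℂ) = (τ / 2) • (1 + I) := by
  have h2 : proj (A ^ 2) ≠ 1 := by
    rw [map_pow]
    exact pow_ne_one_of_lt_orderOf (by norm_num) (by rw [hA]; norm_num)
  have h4 : proj (A ^ 4) = 1 := by rw [map_pow, ← hA, pow_orderOf_eq_one]
  rw [Ne, proj_eq_one_iff, Matrix.SpecialLinearGroup.coe_pow] at h2
  rw [proj_eq_one_iff, Matrix.SpecialLinearGroup.coe_pow] at h4
  have hdet : (A : Matrix (Fin 2) (Fin 2) ℂ).det = 1 := A.det_coe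
  generalize (A : Matrix (Fin 2) (Fin 2) ℂ) = M at *
  have hsq : M ^ 2 = M.trace • M - 1 := by
    rw [Matrix.det_fin_two] at hdet
    ext i j
    fin_cases i <;> fin_cases j <;> simp [pow_two, Matrix.mul_apply, Matrix.trace_fin_two] <;>
      first | ring1 | linear_combination -hdet
  set τ := M.trace with hτ
  have hfour : M ^ 4 = (τ ^ 3 - 2 * τ) • M + (1 - τ ^ 2) • 1 := by
    have h3 : M ^ 3 = τ • M ^ 2 - M := by rw [pow_succ, hsq, sub_mul, smul_mul_assoc, ← pow_two,
      one_mul, hsq]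
    have : M ^ 4 = τ • M ^ 3 - M ^ 2 := by rw [pow_succ, h3, sub_mul, smul_mul_assoc, ← pow_succ,
      ← pow_two, h3]
    rw [this, h3, hsq]
    module
  obtain ⟨ε, hε⟩ : ∃ ε : ℂ, M ^ 4 = ε • 1 := by
    rcases h4 with h | h
    · exact ⟨1, by simp [h]⟩
    · exact ⟨-1, by simp [h]⟩
  -- Otherwise `M⁴` scalar would make `M` scalar, and determinant one would give `M² = 1`.
  have hcube : τ ^ 3 - 2 * τ = 0 := by
    by_contra hne
    have hscal : M = ((τ ^ 3 - 2 * τ)⁻¹ * (ε - (1 - τ ^ 2))) • 1 := by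
      rw [mul_smul, sub_smul, ← hε, hfour, add_sub_cancel_right, smul_smul, inv_mul_cancel₀ hne,
        one_smul]
    generalize (τ ^ 3 - 2 * τ)⁻¹ * (ε - (1 - τ ^ 2)) = c at hscal
    rw [hscal, Matrix.det_smul, Matrix.det_one, mul_one, Fintype.card_fin] at hdet
    exact h2 (.inl (by rw [hscal, smul_pow, hdet, one_pow, one_smul]))
  have hτ0 : τ ≠ 0 := by
    intro h0
    exact h2 (.inr (by rw [hsq, h0, zero_smul, zero_sub]))
  have hτ2 : τ ^ 2 = 2 := by
    apply mul_left_cancel₀ hτ0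
    linear_combination hcube
  refine ⟨τ, τ • M - 1, hτ2, ?_, ?_, ?_⟩
  · have : (τ • M - 1) * (τ • M - 1) = τ ^ 2 • M ^ 2 - (2 * τ) • M + 1 := by
      rw [pow_two M]
      simp only [sub_mul, mul_sub, smul_mul_smul_comm, one_mul, mul_one]
      module
    rw [this, hsq, hτ2]
    module
  · rw [Matrix.trace_sub, Matrix.trace_smul, ← hτ, Matrix.trace_one, Fintype.card_fin, smul_eq_mul]
    push_cast
    linear_combination hτ2
  · rw [add_sub_cancel, smul_smul, show τ / 2 * τ = 1 by linear_combination hτ2 / 2, one_smul]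

/-! ### Square roots of `-1`, integrality of traces, powers of unimodular matrices. -/

section Matrices

variable {I J : Matrix (Fin 2) (Fin 2) ℂ}

theorem mul_comm_of_trace_eq_zero (hI : I.trace = 0) (hJ : J.trace = 0) :
    J * I = (2 * ((I * J).trace / 2)) • 1 - I * J := by
  rw [Matrix.trace_fin_two] at hI hJ
  have hI' := eq_neg_of_add_eq_zero_right hI
  have hJ' := eq_neg_of_add_eq_zero_right hJ
  ext i j
  fin_cases i <;> fin_cases j <;>
    simp [Matrix.mul_apply, Matrix.trace_fin_two, hI', hJ'] <;> ring

theorem det_commutator (hI : I.trace = 0) (hJ : J.trace = 0) (hII : I * I = -1)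
    (hJJ : J * J = -1) : (I * J - J * I).det = 4 * (1 - ((I * J).trace / 2) ^ 2) := by
  rw [Matrix.trace_fin_two] at hI hJ
  have hI' := eq_neg_of_add_eq_zero_right hI
  have hJ' := eq_neg_of_add_eq_zero_right hJ
  have h1 := congr_fun₂ hII 0 0
  have h2 := congr_fun₂ hJJ 0 0
  simp only [Matrix.mul_apply, Fin.sum_univ_two, Matrix.neg_apply, Matrix.one_apply_eq] at h1 h2
  simp only [Matrix.det_fin_two, Matrix.sub_apply, Matrix.mul_apply, Fin.sum_univ_two,
    Matrix.trace_fin_two, hI', hJ']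
  linear_combination 4 * (J 0 0 * J 0 0 + J 0 1 * J 1 0) * h1 - 4 * h2

theorem slGamma_eq {A B : SL(2, ℂ)} {τ τ' : ℂ} (hτ : τ ^ 2 = 2) (hτ' : τ' ^ 2 = 2)
    (hI : I.trace = 0) (hJ : J.trace = 0) (hII : I * I = -1) (hJJ : J * J = -1)
    (hA : (A : Matrix (Fin 2) (Fin 2) ℂ) = (τ / 2) • (1 + I))
    (hB : (B : Matrix (Fin 2) (Fin 2) ℂ) = (τ' / 2) • (1 + J)) :
    slGamma A B = ((I * J).trace / 2) ^ 2 - 1 := by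
  have : (A : Matrix (Fin 2) (Fin 2) ℂ) * B - (B : Matrix (Fin 2) (Fin 2) ℂ) * A =
      (τ / 2 * (τ' / 2)) • (I * J - J * I) := by
    rw [hA, hB]
    simp only [smul_mul_smul_comm, mul_add, add_mul, mul_one, one_mul]
    module
  rw [slGamma_eq_neg_det, this, Matrix.det_smul, det_commutator hI hJ hII hJJ, Fintype.card_fin]
  linear_combination (((I * J).trace / 2) ^ 2 - 1) / 4 * (hτ * τ' ^ 2 + 2 * hτ')

variable {Y : Matrix (Fin 2) (Fin 2) ℂ}

theorem exists_mem_spectrum (hY : Y.det = 1) : ∃ c : ℂ, c ≠ 0 ∧ c ∈ spectrum ℂ Y ∧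
    c⁻¹ ∈ spectrum ℂ Y ∧ c + c⁻¹ = Y.trace := by
  obtain ⟨d, hd⟩ := IsAlgClosed.exists_pow_nat_eq (Y.trace ^ 2 - 4) two_pos
  have hmem : ∀ c : ℂ, c ^ 2 - Y.trace * c + 1 = 0 → c ∈ spectrum ℂ Y := by
    intro c hc
    rw [spectrum.mem_iff, Matrix.isUnit_iff_isUnit_det, isUnit_iff_ne_zero, not_not]
    rw [Matrix.det_fin_two] at hY ⊢
    rw [Matrix.trace_fin_two] at hc
    simp [Matrix.algebraMap_matrix_apply]
    linear_combination hc + hY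
  have hc : ((Y.trace + d) / 2) ^ 2 - Y.trace * ((Y.trace + d) / 2) + 1 = 0 := by
    linear_combination hd / 4
  generalize (Y.trace + d) / 2 = c at hc
  have hc0 : c ≠ 0 := by rintro rfl; simp at hc
  refine ⟨c, hc0, hmem c hc, hmem _ ?_, ?_⟩
  · field_simp
    linear_combination hc
  · field_simp
    linear_combination hc

/-- The trace is the sum of the eigenvalues, which are roots of the monic polynomial annihilating
`Y`. -/
theorem isIntegral_trace (hY : Y.det = 1) (hint : IsIntegral ℤ Y) : IsIntegral ℤ Y.trace := by
  obtain ⟨p, hp, hpY⟩ := hint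
  have key : ∀ c ∈ spectrum ℂ Y, IsIntegral ℤ c := by
    intro c hc
    refine ⟨p, hp, ?_⟩
    have h := spectrum.subset_polynomial_aeval Y (p.map (algebraMap ℤ ℂ)) ⟨c, hc, rfl⟩
    rw [Polynomial.aeval_map_algebraMap, Polynomial.aeval_def, hpY, spectrum.zero_eq] at h
    simpa [Polynomial.eval_map] using h
  obtain ⟨c, -, h1, h2, h3⟩ := exists_mem_spectrum hY
  rw [← h3]
  exact (key _ h1).add (key _ h2)

theorem pow_eq_smul_add_smul (hY : Y.det = 1) (n : ℕ) : ∃ u v : ℂ, Y ^ n = u • Y + v • 1 := by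
  have hsq : Y * Y = Y.trace • Y - 1 := by
    rw [Matrix.det_fin_two] at hY
    ext i j
    fin_cases i <;> fin_cases j <;> simp [Matrix.mul_apply, Matrix.trace_fin_two] <;>
      first | ring1 | linear_combination -hY
  induction n with
  | zero => exact ⟨0, 1, by simp⟩
  | succ n ih =>
    obtain ⟨u, v, h⟩ := ih
    refine ⟨u * Y.trace + v, -u, ?_⟩
    rw [pow_succ, h, add_mul, smul_mul_assoc, hsq, smul_mul_assoc, one_mul]
    module

/-- If `Yⁿ` were scalar, it would be `±1`; the eigenvalues `c`, `c⁻¹` would have modulus one and the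
trace `c + c̄` would be real. -/
theorem exists_pow_eq_smul_add_smul (hY : Y.det = 1) (him : Y.trace.im ≠ 0) {n : ℕ} (hn : n ≠ 0) :
    ∃ u v : ℂ, u ≠ 0 ∧ Y ^ n = u • Y + v • 1 := by
  obtain ⟨u, v, h⟩ := pow_eq_smul_add_smul hY n
  refine ⟨u, v, ?_, h⟩
  rintro rfl
  rw [zero_smul, zero_add] at h
  have hv : v ^ 2 = 1 := by
    have := congr_arg Matrix.det h
    rw [Matrix.det_pow, hY, one_pow, Matrix.det_smul, Matrix.det_one, mul_one,
      Fintype.card_fin] at this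
    exact this.symm
  obtain ⟨c, hc0, h1, -, h3⟩ := exists_mem_spectrum hY
  have hcn : c ^ n = v := by
    have := spectrum.pow_mem_pow Y n h1
    rw [h, ← Algebra.algebraMap_eq_smul_one, spectrum.scalar_eq] at this
    exact this
  have hnorm : ‖c‖ = 1 := by
    have : ‖c‖ ^ (n * 2) = 1 := by rw [← norm_pow, pow_mul, hcn, hv, norm_one]
    exact (pow_eq_one_iff_of_nonneg (norm_nonneg c) (by omega)).1 this
  apply him
  rw [← h3, Complex.inv_def, Complex.normSq_eq_norm_sq, hnorm]
  simp

end Matrices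

/-! ### Trace, conjugation and norm under an embedding of a quaternion algebra. -/

section Embedding

variable {k : Type} [Field k] {a b : k} {σ : k →+* ℂ}
  {ρ : ℍ[k, a, b] →+* Matrix (Fin 2) (Fin 2) ℂ}

theorem trace_eq_zero_of_mul_eq_neg {X Y : Matrix (Fin 2) (Fin 2) ℂ} {c : ℂ} (hc : c ≠ 0)
    (hXY : X * Y = -(Y * X)) (hY : Y * Y = Matrix.scalar (Fin 2) c) : X.trace = 0 := by
  have h1 : (X * (Y * Y)).trace = c * X.trace := by
    rw [hY, Matrix.scalar_apply, ← Matrix.smul_one_eq_diagonal, mul_smul_comm, mul_one, Matrix.trace_smul, smul_eq_mul]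
  have h2 : (X * (Y * Y)).trace = -(X * (Y * Y)).trace := by
    conv_lhs => rw [← mul_assoc, hXY, neg_mul, Matrix.trace_neg, mul_assoc, Matrix.trace_mul_comm, mul_assoc]
  rw [h1] at h2
  have : c * X.trace = 0 := by linear_combination h2 / 2
  exact (mul_eq_zero.1 this).resolve_left hc

/-- Each of the three imaginary units anticommutes with another one whose square is a nonzero
scalar, so its image has trace zero. -/
theorem trace_map (ha : a ≠ 0) (hb : b ≠ 0)
    (hρ : ∀ c : k, ρ (algebraMap k ℍ[k, a, b] c) = Matrix.scalar (Fin 2) (σ c)) (x : ℍ[k, a, b]) :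
    (ρ x).trace = 2 * σ x.re := by
  have hσ : ∀ c : k, c ≠ 0 → σ c ≠ 0 := fun c hc => (map_ne_zero σ).2 hc
  have hi : (ρ ⟨0, 1, 0, 0⟩).trace = 0 := by
    refine trace_eq_zero_of_mul_eq_neg (Y := ρ ⟨0, 0, 1, 0⟩) (hσ b hb) ?_ ?_
    · rw [← map_mul, ← map_mul, ← map_neg]; congr 1; ext <;> simp
    · rw [← map_mul, ← hρ]; congr 1; ext <;> simp
  have hj : (ρ ⟨0, 0, 1, 0⟩).trace = 0 := by
    refine trace_eq_zero_of_mul_eq_neg (Y := ρ ⟨0, 1, 0, 0⟩) (hσ a ha) ?_ ?_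
    · rw [← map_mul, ← map_mul, ← map_neg]; congr 1; ext <;> simp
    · rw [← map_mul, ← hρ]; congr 1; ext <;> simp
  have hk : (ρ ⟨0, 0, 0, 1⟩).trace = 0 := by
    refine trace_eq_zero_of_mul_eq_neg (Y := ρ ⟨0, 1, 0, 0⟩) (hσ a ha) ?_ ?_
    · rw [← map_mul, ← map_mul, ← map_neg]; congr 1; ext <;> simp
    · rw [← map_mul, ← hρ]; congr 1; ext <;> simp
  have hx : x = algebraMap k _ x.re + algebraMap k _ x.imI * ⟨0, 1, 0, 0⟩ +
      algebraMap k _ x.imJ * ⟨0, 0, 1, 0⟩ + algebraMap k _ x.imK * ⟨0, 0, 0, 1⟩ := by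
    ext <;> simp
  have hs : ∀ (c : ℂ) (M : Matrix (Fin 2) (Fin 2) ℂ),
      (Matrix.scalar (Fin 2) c * M).trace = c * M.trace := by
    intro c M
    rw [Matrix.scalar_apply, ← Matrix.smul_one_eq_diagonal, smul_mul_assoc, one_mul, Matrix.trace_smul, smul_eq_mul]
  conv_lhs => rw [hx]
  simp only [map_add, map_mul, hρ, Matrix.trace_add, hs, hi, hj, hk]
  rw [← mul_one (Matrix.scalar (Fin 2) (σ x.re)), hs]
  simp [mul_comm]

theorem map_star (ha : a ≠ 0) (hb : b ≠ 0)
    (hρ : ∀ c : k, ρ (algebraMap k ℍ[k, a, b] c) = Matrix.scalar (Fin 2) (σ c)) (x : ℍ[k, a, b]) :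
    ρ (star x) = (ρ x).adjugate := by
  have hx : star x = algebraMap k _ (x.re + x.re) - x := by
    ext <;> simp
  rw [hx, map_sub, hρ, map_add, ← two_mul, ← trace_map ha hb hρ, Matrix.adjugate_fin_two]
  ext i j
  fin_cases i <;> fin_cases j <;> simp [Matrix.trace_fin_two]

theorem map_mul_star (ha : a ≠ 0) (hb : b ≠ 0)
    (hρ : ∀ c : k, ρ (algebraMap k ℍ[k, a, b] c) = Matrix.scalar (Fin 2) (σ c)) (x : ℍ[k, a, b]) :
    σ (x * star x).re = (ρ x).det := by
  have h := trace_map ha hb hρ (x * star x)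
  rw [map_mul, map_star ha hb hρ, Matrix.mul_adjugate, Matrix.trace_smul, Matrix.trace_one,
    Fintype.card_fin, smul_eq_mul] at h
  push_cast at h
  linear_combination -h / 2

/-- The reduced trace form is nondegenerate, and an element of the kernel is orthogonal to
everything. -/
theorem map_injective (ha : a ≠ 0) (hb : b ≠ 0)
    (hρ : ∀ c : k, ρ (algebraMap k ℍ[k, a, b] c) = Matrix.scalar (Fin 2) (σ c)) :
    Function.Injective ρ := by
  rw [injective_iff_map_eq_zero]
  intro x hx
  have h : ∀ y, (x * y).re = 0 := by
    intro y
    have := trace_map ha hb hρ (x * y)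
    rw [map_mul, hx, zero_mul, Matrix.trace_zero, zero_eq_mul] at this
    exact (map_eq_zero σ).1 (this.resolve_left two_ne_zero)
  have h1 := h 1
  have h2 := h ⟨0, 1, 0, 0⟩
  have h3 := h ⟨0, 0, 1, 0⟩
  have h4 := h ⟨0, 0, 0, 1⟩
  simp [ha, hb] at h1 h2 h3 h4
  ext <;> simp [h1, h2, h3, h4]

theorem map_smul (hρ : ∀ c : k, ρ (algebraMap k ℍ[k, a, b] c) = Matrix.scalar (Fin 2) (σ c))
    (c : k) (x : ℍ[k, a, b]) : ρ (c • x) = σ c • ρ x := by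
  rw [Algebra.smul_def, map_mul, hρ, Matrix.scalar_apply, ← Matrix.smul_one_eq_diagonal, smul_mul_assoc, one_mul]

end Embedding
-- Multiplication and conjugation formulas in the basis of the new order.
section Algebra

variable {k : Type*} [Field k] [CharZero k] {A : Type*} [Ring A] [Algebra k A]

/-- The combination of `1`, `i`, `j` and `(1 + i) (1 + j) / 2` with coefficients `p`, `q`, `r`, `s`. -/
def comb (i j : A) (p q r s : k) : A := p • 1 + q • i + r • j + (s / 2) • (1 + i + j + i * j)

variable {i j : A} {t : k}

theorem comb_add (p q r s p' q' r' s' : k) : comb i j p q r s + comb i j p' q' r' s' =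
    comb i j (p + p') (q + q') (r + r') (s + s') := by
  unfold comb; module

/-- All structure constants lie in `ℤ[t]`: despite the denominator in the fourth basis element,
integral `t` gives a ring. -/
theorem comb_mul (hii : i * i = -1) (hjj : j * j = -1) (hji : j * i = (2 * t) • 1 - i * j)
    (p q r s p' q' r' s' : k) : comb i j p q r s * comb i j p' q' r' s' =
    comb i j
      (p * p' - q * q' - q * r' - q * s' + r * q' * (2 * t + 1) - r * r' + r * s' * t + s * q' * t
        - s * r' - s * s')
      (p * q' + q * p' - q * r' + r * q' + r * s' + s * q' * (1 + t) - s * r')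
      (p * r' + r * p' - q * r' - q * s' + r * q' + r * s' * (t + 1) + s * q')
      (p * s' + s * p' + 2 * (q * r') + q * s' - 2 * (r * q') - r * s' - s * q' + s * r'
        + s * s' * (1 + t)) := by
  have hii' : ∀ x, i * (i * x) = -x := fun x => by rw [← mul_assoc, hii, neg_one_mul]
  have hji' : ∀ x, j * (i * x) = (2 * t) • x - i * (j * x) := fun x => by
    rw [← mul_assoc, hji, sub_mul, smul_mul_assoc, one_mul, mul_assoc]
  simp only [comb, mul_add, add_mul, smul_mul_assoc, mul_smul_comm, one_mul, mul_one, mul_assoc,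
    hii, hjj, hji, hii', hji', mul_sub, mul_neg]
  module

/-- As `(1 + i)⁻¹ = (1 - i)/2`, this is conjugation by the lift of `f`, with coefficients in `ℤ[t]`.
-/
theorem one_add_mul_comb_mul (hii : i * i = -1) (hji : j * i = (2 * t) • 1 - i * j)
    (p q r s : k) : (1 + i) * comb i j p q r s * (1 - i) =
    (2 : k) • comb i j (p - r * (1 + t)) (q - r * (1 + t) - s * t)
      (-r - s) (s + 2 * r) := by
  have hii' : ∀ x, i * (i * x) = -x := fun x => by rw [← mul_assoc, hii, neg_one_mul]
  simp only [comb, mul_add, add_mul, smul_mul_assoc, mul_smul_comm, one_mul, mul_one, mul_assoc,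
    hii, hji, hii', mul_sub, neg_mul]
  module

/-- As `(i + j)² = 2t - 2`, this is conjugation by `i + j`, again with coefficients in `ℤ[t]`. -/
theorem add_mul_comb_mul (hii : i * i = -1) (hjj : j * j = -1)
    (hji : j * i = (2 * t) • 1 - i * j) (p q r s : k) :
    (i + j) * comb i j p q r s * (i + j) =
    (2 * t - 2) • comb i j (p + s * (t + 1)) (r + s) (q + s) (-s) := by
  have hii' : ∀ x, i * (i * x) = -x := fun x => by rw [← mul_assoc, hii, neg_one_mul]
  have hji' : ∀ x, j * (i * x) = (2 * t) • x - i * (j * x) := fun x => by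
    rw [← mul_assoc, hji, sub_mul, smul_mul_assoc, one_mul, mul_assoc]
  simp only [comb, mul_add, add_mul, smul_mul_assoc, mul_smul_comm, one_mul, mul_one, mul_assoc,
    hii, hjj, hji, hii', hji', mul_sub, sub_mul, mul_neg, neg_mul]
  module

end Algebra

/-! ### Recovering `I` inside the quaternion algebra. -/

section Commensurable

variable {k : Type} [Field k] {a b : k} {σ : k →+* ℂ}
  {ρ : ℍ[k, a, b] →+* Matrix (Fin 2) (Fin 2) ℂ}

/-- Here `y` and `z` represent the conjugates of `M` by `(1 + I)/√2` and by its square `I`. Both `D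
= M + IMI` and `ID = IM - MI` are combinations of `x`, `y`, `z`, so `I` is a quotient in the algebra
once `D` is invertible. -/
theorem exists_map_eq (ha : a ≠ 0) (hb : b ≠ 0)
    (hρ : ∀ c : k, ρ (algebraMap k ℍ[k, a, b] c) = Matrix.scalar (Fin 2) (σ c))
    {I J M : Matrix (Fin 2) (Fin 2) ℂ} {t u v : ℂ} (hII : I * I = -1) (hJJ : J * J = -1)
    (hJI : J * I = (2 * t) • 1 - I * J) (ht : t ^ 2 ≠ 1) (hu : u ≠ 0)
    (hM : M = u • ((1 + I) * (1 + J)) + v • 1) {x y z : ℍ[k, a, b]} (hx : ρ x = M)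
    (hy : (2 : ℂ) • ρ y = (1 + I) * M * (1 - I)) (hz : ρ z = -(I * M * I)) :
    ∃ w, ρ w = I := by
  have hII' : ∀ x, I * (I * x) = -x := fun x => by rw [← mul_assoc, hII, neg_one_mul]
  have hJI' : ∀ x, J * (I * x) = (2 * t) • x - I * (J * x) := fun x => by
    rw [← mul_assoc, hJI, sub_mul, smul_mul_assoc, one_mul, mul_assoc]
  have hd : ρ (x - z) = M + I * M * I := by rw [map_sub, hx, hz, sub_neg_eq_add]
  have he : ρ (y + y - x - z) = I * ρ (x - z) := by
    rw [hd, map_sub, map_sub, map_add, ← two_smul ℂ (ρ y), hy, hx, hz]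
    simp only [add_mul, mul_sub, mul_add, mul_one, one_mul, mul_assoc, hII']
    abel
  have hdet : (ρ (x - z)).det ≠ 0 := by
    -- `J + tI` anticommutes with `I` and has square `t² - 1`, while `D = 2u(1 + I)(J + tI)`; this
    -- exhibits the inverse of `D` up to a scalar.
    have : ρ (x - z) * ((J + t • I) * (1 - I)) = (4 * u * (t ^ 2 - 1)) • 1 := by
      rw [hd, hM]
      simp only [mul_add, add_mul, smul_mul_assoc, mul_smul_comm, one_mul, mul_one, mul_assoc,
        hII, hJJ, hJI, hII', hJI', mul_sub, sub_mul, mul_neg, neg_mul]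
      module
    intro h0
    have h := congr_arg Matrix.det this
    rw [Matrix.det_mul, h0, zero_mul, Matrix.det_smul, Matrix.det_one, mul_one, eq_comm,
      pow_eq_zero_iff (by simp)] at h
    simp [hu, sub_eq_zero, ht] at h
  refine ⟨((x - z) * star (x - z)).re⁻¹ • ((y + y - x - z) * star (x - z)), ?_⟩
  rw [map_smul hρ, map_mul, map_star ha hb hρ, he, mul_assoc, Matrix.mul_adjugate, map_inv₀,
    map_mul_star ha hb hρ, mul_smul_comm, smul_smul, inv_mul_cancel₀ hdet, one_smul, mul_one]

theorem exists_map_eq_of_proj_mem [NumberField k] {O : Subalgebra (𝓞 k) ℍ[k, a, b]}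
    {M : SL(2, ℂ)} (hM : proj M ∈ (normOneImage O ρ).map proj) :
    ∃ x ∈ O, ρ x = (M : Matrix (Fin 2) (Fin 2) ℂ) := by
  obtain ⟨N, ⟨u, -, hu⟩, hN⟩ := hM
  have h : proj (N⁻¹ * M) = 1 := by rw [map_mul, map_inv, hN, inv_mul_cancel]
  have hMN : (M : Matrix (Fin 2) (Fin 2) ℂ) = (N : Matrix (Fin 2) (Fin 2) ℂ) *
      ((N⁻¹ * M : SL(2, ℂ)) : Matrix (Fin 2) (Fin 2) ℂ) := by
    rw [← Matrix.SpecialLinearGroup.coe_mul, mul_inv_cancel_left]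
  rcases proj_eq_one_iff.1 h with h | h <;> rw [h] at hMN
  · exact ⟨_, (u : O).2, by rw [hu, hMN, mul_one]⟩
  · exact ⟨_, neg_mem (u : O).2, by rw [map_neg, hu, hMN, mul_neg, mul_one]⟩

theorem IsOrder.isIntegral [NumberField k] {O : Subalgebra (𝓞 k) ℍ[k, a, b]} (hO : IsOrder O)
    {x : ℍ[k, a, b]} (hx : x ∈ O) : IsIntegral ℤ x :=
  have h : IsIntegral (𝓞 k) x := IsIntegral.of_mem_of_fg O hO.1 x hx
  @isIntegral_trans ℤ (𝓞 k) ℍ[k, a, b] _ _ _ _ _ _ (.of_algebraMap_eq (by simp)) _ x h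

end Commensurable
-- The order spanned by `1`, `i`, `j`, `(1 + i)(1 + j)/2`.
theorem fg_of_forall_mem_iff {S A ι : Type*} [CommRing S] [Ring A] [Algebra S A] [Fintype ι]
    {N : Submodule S A} (v : ι → A) (h : ∀ x, x ∈ N ↔ ∃ c : ι → S, ∑ n, c n • v n = x) :
    N.FG := by
  have : N = LinearMap.range (Fintype.linearCombination S v) := by
    ext x
    rw [h, LinearMap.mem_range]
    rfl
  rw [this, LinearMap.range_eq_map]
  exact Module.Finite.fg_top.map _

section Order

variable {k : Type} [Field k] [NumberField k] {a b : k} {i j : ℍ[k, a, b]} {t : 𝓞 k}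

/-- The order with `𝓞 k`-basis `1`, `i`, `j`, `(1 + i) (1 + j) / 2`, where `i² = j² = -1` and
`i j + j i = 2 t`. -/
def combOrder (hii : i * i = -1) (hjj : j * j = -1)
    (hji : j * i = (2 * (t : k)) • 1 - i * j) : Subalgebra (𝓞 k) ℍ[k, a, b] where
  carrier := {x | ∃ p q r s : 𝓞 k, x = comb i j (p : k) q r s}
  add_mem' := by
    rintro _ _ ⟨p, q, r, s, rfl⟩ ⟨p', q', r', s', rfl⟩
    exact ⟨p + p', q + q', r + r', s + s', by rw [comb_add]; push_cast; rfl⟩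
  mul_mem' := by
    rintro _ _ ⟨p, q, r, s, rfl⟩ ⟨p', q', r', s', rfl⟩
    refine ⟨p * p' - q * q' - q * r' - q * s' + r * q' * (2 * t + 1) - r * r' + r * s' * t
      + s * q' * t - s * r' - s * s',
      p * q' + q * p' - q * r' + r * q' + r * s' + s * q' * (1 + t) - s * r',
      p * r' + r * p' - q * r' - q * s' + r * q' + r * s' * (t + 1) + s * q',
      p * s' + s * p' + 2 * (q * r') + q * s' - 2 * (r * q') - r * s' - s * q' + s * r'
        + s * s' * (1 + t), ?_⟩
    rw [comb_mul hii hjj hji]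
    push_cast
    rfl
  algebraMap_mem' c := ⟨c, 0, 0, 0, by
    simp [comb, IsScalarTower.algebraMap_apply (𝓞 k) k ℍ[k, a, b], Algebra.algebraMap_eq_smul_one]⟩

theorem mem_combOrder (hii : i * i = -1) (hjj : j * j = -1)
    (hji : j * i = (2 * (t : k)) • 1 - i * j) {x : ℍ[k, a, b]} :
    x ∈ combOrder hii hjj hji ↔ ∃ p q r s : 𝓞 k, x = comb i j (p : k) q r s := Iff.rfl

theorem re_comb (hji : j * i = (2 * (t : k)) • 1 - i * j) (hi : i.re = 0) (hj : j.re = 0)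
    (p q r s : k) : (comb i j p q r s).re = p + s * (1 + t) / 2 := by
  have hcomm : (j * i).re = (i * j).re := by simp; ring
  have h : (i * j).re = t := by
    have := congr_arg QuaternionAlgebra.re hji
    rw [hcomm, QuaternionAlgebra.re_sub, QuaternionAlgebra.re_smul, QuaternionAlgebra.re_one,
      smul_eq_mul] at this
    linear_combination this / 2
  simp only [comb, QuaternionAlgebra.re_add, QuaternionAlgebra.re_smul, QuaternionAlgebra.re_one,
    hi, hj, h, smul_eq_mul]
  ring

/-- Pairing with the four basis elements under the trace form gives a linear system that is
nonsingular when `t² ≠ 1`. -/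
theorem comb_eq_zero (hii : i * i = -1) (hjj : j * j = -1)
    (hji : j * i = (2 * (t : k)) • 1 - i * j) (hi : i.re = 0) (hj : j.re = 0)
    (ht : (t : k) ^ 2 ≠ 1) {p q r s : k} (h : comb i j p q r s = 0) :
    p = 0 ∧ q = 0 ∧ r = 0 ∧ s = 0 := by
  have key : ∀ p' q' r' s' : k, (comb i j p q r s * comb i j p' q' r' s').re = 0 := by
    intro p' q' r' s'
    rw [h, zero_mul, QuaternionAlgebra.re_zero]
  simp only [comb_mul hii hjj hji, re_comb hji hi hj] at key
  have e1 := key 1 0 0 0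
  have e2 := key 0 1 0 0
  have e3 := key 0 0 1 0
  have e4 := key 0 0 0 1
  have ht' : (t : k) ^ 2 - 1 ≠ 0 := sub_ne_zero.2 ht
  have hs : s = 0 := by
    apply mul_left_cancel₀ ht'
    linear_combination 4 * e4 - 2 * e1 - 2 * e2 - 2 * e3 - 2 * t * e1
  subst hs
  have hq : q = 0 := by
    apply mul_left_cancel₀ ht'
    linear_combination e2 + t * e3
  subst hq
  exact ⟨by linear_combination e1, rfl, by linear_combination -e3, rfl⟩

theorem isOrder_combOrder (hii : i * i = -1) (hjj : j * j = -1)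
    (hji : j * i = (2 * (t : k)) • 1 - i * j) (hi : i.re = 0) (hj : j.re = 0)
    (ht : (t : k) ^ 2 ≠ 1) : IsOrder (combOrder hii hjj hji) := by
  constructor
  · refine fg_of_forall_mem_iff ![1, i, j, ((1 : k) / 2) • (1 + i + j + i * j)] fun x => ?_
    have hφ : ∀ v : Fin 4 → 𝓞 k, ∑ n, v n • ![1, i, j, ((1 : k) / 2) • (1 + i + j + i * j)] n =
        comb i j (v 0 : k) (v 1) (v 2) (v 3) := by
      intro v
      simp only [Fin.sum_univ_four, comb, ← algebraMap_smul k (v _)]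
      simp
      module
    rw [Subalgebra.mem_toSubmodule, mem_combOrder]
    constructor
    · rintro ⟨p, q, r, s, rfl⟩
      exact ⟨![p, q, r, s], hφ _⟩
    · rintro ⟨v, rfl⟩
      exact ⟨_, _, _, _, hφ v⟩
  · have hli : LinearIndependent k ![1, i, j, ((1 : k) / 2) • (1 + i + j + i * j)] := by
      rw [Fintype.linearIndependent_iff]
      intro g hg
      have h : comb i j (g 0) (g 1) (g 2) (g 3) = 0 := by
        rw [← hg, Fin.sum_univ_four, comb]
        simp
        module
      obtain ⟨h0, h1, h2, h3⟩ := comb_eq_zero hii hjj hji hi hj ht h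
      intro n
      fin_cases n <;> assumption
    have htop := hli.span_eq_top_of_card_eq_finrank (by
      rw [QuaternionAlgebra.finrank_eq_four, Fintype.card_fin])
    rw [eq_top_iff, ← htop]
    apply Submodule.span_mono
    rintro _ ⟨n, rfl⟩
    fin_cases n
    · exact ⟨1, 0, 0, 0, by simp [comb]⟩
    · exact ⟨0, 1, 0, 0, by simp [comb]⟩
    · exact ⟨0, 0, 1, 0, by simp [comb]⟩
    · exact ⟨0, 0, 0, 1, by simp [comb]⟩

/-- The reduced trace `2p + s(1 + t)` is integral. Hence elements of norm one in the order are
automatically units of it. -/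
theorem star_mem_combOrder (hii : i * i = -1) (hjj : j * j = -1)
    (hji : j * i = (2 * (t : k)) • 1 - i * j) (hi : i.re = 0) (hj : j.re = 0)
    {x : ℍ[k, a, b]} (hx : x ∈ combOrder hii hjj hji) : star x ∈ combOrder hii hjj hji := by
  obtain ⟨p, q, r, s, rfl⟩ := hx
  refine ⟨p + s * (1 + t), -q, -r, -s, ?_⟩
  have hstar : ∀ x : ℍ[k, a, b], star x = (2 * x.re) • 1 - x := fun x => by
    ext <;> simp; ring
  rw [hstar, re_comb hji hi hj]
  unfold comb
  push_cast
  module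

variable {σ : k →+* ℂ} {ρ : ℍ[k, a, b] →+* Matrix (Fin 2) (Fin 2) ℂ}

theorem mem_normOneImage_combOrder (ha : a ≠ 0) (hb : b ≠ 0)
    (hρ : ∀ c : k, ρ (algebraMap k ℍ[k, a, b] c) = Matrix.scalar (Fin 2) (σ c))
    (hii : i * i = -1) (hjj : j * j = -1)
    (hji : j * i = (2 * (t : k)) • 1 - i * j) (hi : i.re = 0) (hj : j.re = 0) {M : SL(2, ℂ)} :
    M ∈ normOneImage (combOrder hii hjj hji) ρ ↔
      ∃ x ∈ combOrder hii hjj hji, ρ x = (M : Matrix (Fin 2) (Fin 2) ℂ) := by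
  constructor
  · rintro ⟨u, -, hu⟩
    exact ⟨_, (u : combOrder hii hjj hji).2, hu⟩
  · rintro ⟨x, hx, hxM⟩
    have hstar := star_mem_combOrder hii hjj hji hi hj hx
    have h1 : x * star x = 1 := by
      apply map_injective ha hb hρ
      rw [map_mul, map_star ha hb hρ, Matrix.mul_adjugate, hxM, M.det_coe, one_smul, map_one]
    have h2 : star x * x = 1 := by
      apply map_injective ha hb hρ
      rw [map_mul, map_star ha hb hρ, Matrix.adjugate_mul, hxM, M.det_coe, one_smul, map_one]
    exact ⟨⟨⟨x, hx⟩, ⟨star x, hstar⟩, Subtype.ext h1, Subtype.ext h2⟩, h1, hxM⟩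

end Order
-- Consequences of commensurability for the lifts of `f` and `g`.
section Lifts

variable {A B : SL(2, ℂ)} {τ τ' : ℂ} {I J : Matrix (Fin 2) (Fin 2) ℂ}

theorem trace_mul_eq (hI : I.trace = 0) (hJ : J.trace = 0)
    (hA : (A : Matrix (Fin 2) (Fin 2) ℂ) = (τ / 2) • (1 + I))
    (hB : (B : Matrix (Fin 2) (Fin 2) ℂ) = (τ' / 2) • (1 + J)) :
    ((A * B : SL(2, ℂ)) : Matrix (Fin 2) (Fin 2) ℂ).trace =
      τ * τ' / 2 * (1 + (I * J).trace / 2) := by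
  rw [Matrix.SpecialLinearGroup.coe_mul, hA, hB, smul_mul_smul_comm]
  simp only [add_mul, mul_add, one_mul, mul_one, Matrix.trace_smul, Matrix.trace_add, hI, hJ,
    Matrix.trace_one, Fintype.card_fin, smul_eq_mul]
  push_cast
  ring

theorem mul_div_two_eq_one_or (hτ : τ ^ 2 = 2) (hτ' : τ' ^ 2 = 2) :
    τ * τ' / 2 = 1 ∨ τ * τ' / 2 = -1 := by
  rw [← mul_self_eq_one_iff]
  linear_combination τ' ^ 2 / 4 * hτ + hτ' / 2

theorem trace_mul_im_ne_zero (hτ : τ ^ 2 = 2) (hτ' : τ' ^ 2 = 2) (hI : I.trace = 0)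
    (hJ : J.trace = 0) (hA : (A : Matrix (Fin 2) (Fin 2) ℂ) = (τ / 2) • (1 + I))
    (hB : (B : Matrix (Fin 2) (Fin 2) ℂ) = (τ' / 2) • (1 + J))
    (him : (((I * J).trace / 2) ^ 2).im ≠ 0) :
    ((A * B : SL(2, ℂ)) : Matrix (Fin 2) (Fin 2) ℂ).trace.im ≠ 0 := by
  rw [trace_mul_eq hI hJ hA hB]
  contrapose him
  generalize (I * J).trace / 2 = t at *
  have : t.im = 0 := by
    rcases mul_div_two_eq_one_or hτ hτ' with h | h <;> rw [h] at him <;> simpa using him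
  simp [pow_two, this]

theorem coe_inv_eq (hI : I.trace = 0)
    (hA : (A : Matrix (Fin 2) (Fin 2) ℂ) = (τ / 2) • (1 + I)) :
    ((A⁻¹ : SL(2, ℂ)) : Matrix (Fin 2) (Fin 2) ℂ) = (τ / 2) • (1 - I) := by
  rw [Matrix.trace_fin_two] at hI
  have hI' := eq_neg_of_add_eq_zero_right hI
  rw [Matrix.SpecialLinearGroup.coe_inv, hA, Matrix.adjugate_fin_two]
  ext i j
  fin_cases i <;> fin_cases j <;> simp [hI', sub_eq_add_neg]

variable {k : Type} [Field k] [NumberField k] {a b : k} {σ : k →+* ℂ}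
  {ρ : ℍ[k, a, b] →+* Matrix (Fin 2) (Fin 2) ℂ}

/-- If all `n`-th powers in `⟨f, g⟩` are in the image of an order, the algebra of the order contains
the square root of `-1` which belongs to `f`. -/
theorem exists_map_eq_of_pow_mem (ha : a ≠ 0) (hb : b ≠ 0)
    (hρ : ∀ c : k, ρ (algebraMap k ℍ[k, a, b] c) = Matrix.scalar (Fin 2) (σ c))
    {O : Subalgebra (𝓞 k) ℍ[k, a, b]} {n : ℕ} (hn : n ≠ 0)
    (hpow : ∀ y ∈ Subgroup.closure {proj A, proj B}, y ^ n ∈ (normOneImage O ρ).map proj)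
    (hτ : τ ^ 2 = 2) (hτ' : τ' ^ 2 = 2) (hI : I.trace = 0) (hJ : J.trace = 0)
    (hII : I * I = -1) (hJJ : J * J = -1)
    (hA : (A : Matrix (Fin 2) (Fin 2) ℂ) = (τ / 2) • (1 + I))
    (hB : (B : Matrix (Fin 2) (Fin 2) ℂ) = (τ' / 2) • (1 + J))
    (him : (((I * J).trace / 2) ^ 2).im ≠ 0) : ∃ w, ρ w = I := by
  have hAmem : proj A ∈ Subgroup.closure {proj A, proj B} := Subgroup.subset_closure (by simp)
  have hBmem : proj B ∈ Subgroup.closure {proj A, proj B} := Subgroup.subset_closure (by simp)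
  have hABmem := mul_mem hAmem hBmem
  -- The `n`-th power of `AB` and its conjugates by `A` and `A²` are themselves `n`-th powers in
  -- `⟨f, g⟩`.
  obtain ⟨x, -, hx⟩ := exists_map_eq_of_proj_mem (M := (A * B) ^ n) (by
    rw [map_pow, map_mul]; exact hpow _ hABmem)
  obtain ⟨y, -, hy⟩ := exists_map_eq_of_proj_mem (M := A * (A * B) ^ n * A⁻¹) (by
    rw [← conj_pow, map_pow]; simp only [map_mul, map_inv]
    exact hpow _ (mul_mem (mul_mem hAmem hABmem) (inv_mem hAmem)))
  obtain ⟨z, -, hz⟩ := exists_map_eq_of_proj_mem (M := A * (A * (A * B) ^ n * A⁻¹) * A⁻¹) (by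
    rw [← conj_pow, ← conj_pow, map_pow]; simp only [map_mul, map_inv]
    exact hpow _ (mul_mem (mul_mem hAmem (mul_mem (mul_mem hAmem hABmem) (inv_mem hAmem)))
      (inv_mem hAmem)))
  obtain ⟨u, v, hu, hM⟩ := exists_pow_eq_smul_add_smul (A * B).det_coe
    (trace_mul_im_ne_zero hτ hτ' hI hJ hA hB him) hn
  have hII' : ∀ x, I * (I * x) = -x := fun x => by rw [← mul_assoc, hII, neg_one_mul]
  have hA' := coe_inv_eq hI hA
  have hτ0 : τ ≠ 0 := by rintro rfl; norm_num at hτ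
  have hτ0' : τ' ≠ 0 := by rintro rfl; norm_num at hτ'
  simp only [Matrix.SpecialLinearGroup.coe_mul, Matrix.SpecialLinearGroup.coe_pow] at hx hy hz hM
  rw [hA'] at hy hz
  generalize ((A : Matrix (Fin 2) (Fin 2) ℂ) * B) ^ n = M at *
  rw [hA] at hy hz
  refine exists_map_eq ha hb hρ hII hJJ (mul_comm_of_trace_eq_zero hI hJ)
    (t := (I * J).trace / 2) (u := u * (τ / 2 * (τ' / 2))) (v := v) (y := y) (z := z) ?_
    (by simp [hu, hτ0, hτ0']) ?_
    hx ?_ ?_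
  · intro h; rw [h] at him; simp at him
  · rw [hM, hA, hB, smul_mul_smul_comm, smul_smul]
  · rw [hy, smul_mul_assoc, smul_mul_smul_comm, smul_smul,
      show 2 * (τ / 2 * (τ / 2)) = 1 by linear_combination hτ / 2, one_smul]
  · have : (1 + I) * ((1 + I) * M * (1 - I)) * (1 - I) = (4 : ℂ) • -(I * M * I) := by
      simp only [add_mul, mul_add, mul_sub, sub_mul, one_mul, mul_one, mul_assoc, hII, hII',
        mul_neg, neg_mul]
      module
    simp only [smul_mul_assoc, mul_smul_comm, smul_smul, ← mul_assoc] at hz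
    simp only [← mul_assoc] at this
    rw [hz, this, smul_smul, show τ / 2 * (τ / 2) * (τ / 2) * (τ / 2) * 4 = 1 by
      linear_combination (τ ^ 2 + 2) / 4 * hτ, one_smul]

theorem isIntegral_trace_mul_div_two {O : Subalgebra (𝓞 k) ℍ[k, a, b]} (hO : IsOrder O)
    {n : ℕ} (hn : n ≠ 0)
    (hpow : (proj A * proj B) ^ n ∈ (normOneImage O ρ).map proj)
    (hτ : τ ^ 2 = 2) (hτ' : τ' ^ 2 = 2) (hI : I.trace = 0) (hJ : J.trace = 0)
    (hA : (A : Matrix (Fin 2) (Fin 2) ℂ) = (τ / 2) • (1 + I))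
    (hB : (B : Matrix (Fin 2) (Fin 2) ℂ) = (τ' / 2) • (1 + J)) :
    IsIntegral ℤ ((I * J).trace / 2) := by
  obtain ⟨x, hx, hxM⟩ := exists_map_eq_of_proj_mem (M := (A * B) ^ n) (by
    rwa [map_pow, map_mul])
  have h : IsIntegral ℤ (((A * B : SL(2, ℂ)) : Matrix (Fin 2) (Fin 2) ℂ) ^ n) := by
    rw [← Matrix.SpecialLinearGroup.coe_pow, ← hxM]
    exact (hO.isIntegral hx).map ρ.toIntAlgHom
  have htr := isIntegral_trace (A * B).det_coe (h.of_pow (Nat.pos_of_ne_zero hn))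
  rw [trace_mul_eq hI hJ hA hB] at htr
  rcases mul_div_two_eq_one_or hτ hτ' with h1 | h1 <;> rw [h1] at htr
  · simpa using htr.sub isIntegral_one
  · simpa using htr.neg.sub isIntegral_one

end Lifts

/-! ### The involution `I + J`. -/

section Involution

variable {I J : Matrix (Fin 2) (Fin 2) ℂ} {t : ℂ}

theorem add_mul_self (hII : I * I = -1) (hJJ : J * J = -1) (hJI : J * I = (2 * t) • 1 - I * J) :
    (I + J) * (I + J) = (2 * t - 2) • 1 := by
  simp only [add_mul, mul_add, hII, hJJ, hJI]
  module

theorem exists_specialLinearGroup_eq_smul_add (hI : I.trace = 0) (hJ : J.trace = 0)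
    (hII : I * I = -1) (hJJ : J * J = -1) (hJI : J * I = (2 * t) • 1 - I * J) (ht : t ≠ 1) :
    ∃ (δ : ℂ) (C : SL(2, ℂ)), δ ^ 2 * (2 - 2 * t) = 1 ∧
      (C : Matrix (Fin 2) (Fin 2) ℂ) = δ • (I + J) := by
  have ht' : 2 - 2 * t ≠ 0 := fun h => ht (by linear_combination -h / 2)
  obtain ⟨δ, hδ⟩ := IsAlgClosed.exists_pow_nat_eq (2 - 2 * t)⁻¹ two_pos
  have hdet : (I + J).det = 2 - 2 * t := by
    have h0 := congr_fun₂ (add_mul_self hII hJJ hJI) 0 0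
    have htr : (I + J).trace = 0 := by rw [Matrix.trace_add, hI, hJ, add_zero]
    generalize I + J = X at *
    rw [Matrix.trace_fin_two] at htr
    simp only [Matrix.mul_apply, Fin.sum_univ_two, Matrix.smul_apply, Matrix.one_apply_eq,
      smul_eq_mul, mul_one] at h0
    rw [Matrix.det_fin_two]
    linear_combination X 0 0 * htr - h0
  refine ⟨δ, ⟨δ • (I + J), ?_⟩, by rw [hδ, inv_mul_cancel₀ ht'], rfl⟩
  rw [Matrix.det_smul, hdet, Fintype.card_fin, hδ, inv_mul_cancel₀ ht']

end Involution

theorem proj_mem_normalizer {k : Type} [Field k] [NumberField k] {a b : k}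
    {ρ : ℍ[k, a, b] →+* Matrix (Fin 2) (Fin 2) ℂ} {O : Subalgebra (𝓞 k) ℍ[k, a, b]}
    (hO : ∀ M : SL(2, ℂ), M ∈ normOneImage O ρ ↔
      ∃ x ∈ O, ρ x = (M : Matrix (Fin 2) (Fin 2) ℂ))
    {C : SL(2, ℂ)} (hC : IsOfFinOrder (proj C))
    (h : ∀ x ∈ O, ∃ y ∈ O, (C : Matrix (Fin 2) (Fin 2) ℂ) * ρ x = ρ y * C) :
    proj C ∈ Subgroup.normalizer ((normOneImage O ρ).map proj : Set PSL(2, ℂ)) := by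
  refine Subgroup.mem_normalizer_of_isOfFinOrder hC ?_
  rintro _ ⟨M, hM, rfl⟩
  obtain ⟨x, hx, hxM⟩ := (hO M).1 hM
  obtain ⟨y, hy, hyM⟩ := h x hx
  refine ⟨C * M * C⁻¹, (hO _).2 ⟨y, hy, ?_⟩, by simp only [map_mul, map_inv]⟩
  rw [Matrix.SpecialLinearGroup.coe_mul, Matrix.SpecialLinearGroup.coe_mul, ← hxM, hyM, mul_assoc,
    ← Matrix.SpecialLinearGroup.coe_mul, mul_inv_cancel, Matrix.SpecialLinearGroup.coe_one, mul_one]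

/-! ### Conjugation, discreteness and arithmeticity for the involution. -/

section Core

variable {A B C : SL(2, ℂ)} {τ τ' δ : ℂ} {I J : Matrix (Fin 2) (Fin 2) ℂ}

/-- `(I + J)(1 + I) = (1 + J)(I + J)` because `I² = J²`; the remaining scalar `ττ'/2 = ±1` dies in
`PSL(2, ℂ)`. -/
theorem conj_eq (hτ : τ ^ 2 = 2) (hτ' : τ' ^ 2 = 2) (hII : I * I = -1) (hJJ : J * J = -1)
    (hA : (A : Matrix (Fin 2) (Fin 2) ℂ) = (τ / 2) • (1 + I))
    (hB : (B : Matrix (Fin 2) (Fin 2) ℂ) = (τ' / 2) • (1 + J))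
    (hC : (C : Matrix (Fin 2) (Fin 2) ℂ) = δ • (I + J)) :
    proj C * proj A * (proj C)⁻¹ = proj B := by
  have h : (C : Matrix (Fin 2) (Fin 2) ℂ) * A =
      (τ * τ' / 2) • ((B : Matrix (Fin 2) (Fin 2) ℂ) * C) := by
    rw [hA, hB, hC, smul_mul_smul_comm, smul_mul_smul_comm, smul_smul]
    have : (I + J) * (1 + I) = (1 + J) * (I + J) := by
      simp only [add_mul, mul_add, one_mul, mul_one, hII, hJJ]
      abel
    rw [this]
    congr 1
    linear_combination -(δ * τ / 4) * hτ'
  have hCA : proj (C * A) = proj (B * C) := by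
    rw [← div_eq_one, ← map_div, proj_eq_one_iff, div_eq_mul_inv,
      Matrix.SpecialLinearGroup.coe_mul, Matrix.SpecialLinearGroup.coe_mul, h,
      ← Matrix.SpecialLinearGroup.coe_mul, smul_mul_assoc, ← Matrix.SpecialLinearGroup.coe_mul,
      mul_inv_cancel, Matrix.SpecialLinearGroup.coe_one]
    rcases mul_div_two_eq_one_or hτ hτ' with h1 | h1 <;> rw [h1]
    · exact .inl (one_smul _ _)
    · exact .inr (neg_one_smul _ _)
  rw [mul_inv_eq_iff_eq_mul, ← map_mul, hCA, map_mul]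

theorem orderOf_proj_eq_two {t : ℂ} (hII : I * I = -1) (hJJ : J * J = -1)
    (hJI : J * I = (2 * t) • 1 - I * J) (hδ : δ ^ 2 * (2 - 2 * t) = 1)
    (hC : (C : Matrix (Fin 2) (Fin 2) ℂ) = δ • (I + J)) : orderOf (proj C) = 2 := by
  have hsq : (C : Matrix (Fin 2) (Fin 2) ℂ) ^ 2 = -1 := by
    rw [hC, pow_two, smul_mul_smul_comm, add_mul_self hII hJJ hJI, smul_smul,
      show δ * δ * (2 * t - 2) = -1 by linear_combination -hδ, neg_one_smul]
  apply orderOf_eq_prime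
  · rw [← map_pow, proj_eq_one_iff, Matrix.SpecialLinearGroup.coe_pow]
    exact .inr hsq
  · rw [Ne, proj_eq_one_iff]
    have hne : (1 : Matrix (Fin 2) (Fin 2) ℂ) ≠ -1 := by
      intro h
      have := congr_fun₂ h 0 0
      norm_num at this
    rintro (h | h) <;> rw [h] at hsq
    · exact hne (by simpa using hsq)
    · exact hne (by simpa using hsq)

theorem gamma_proj_eq (hτ : τ ^ 2 = 2) (hI : I.trace = 0) (hJ : J.trace = 0)
    (hII : I * I = -1) (hJJ : J * J = -1) (hδ : δ ^ 2 * (2 - 2 * ((I * J).trace / 2)) = 1)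
    (hA : (A : Matrix (Fin 2) (Fin 2) ℂ) = (τ / 2) • (1 + I))
    (hC : (C : Matrix (Fin 2) (Fin 2) ℂ) = δ • (I + J)) :
    gamma (proj A) (proj C) = -1 - (I * J).trace / 2 := by
  have : (A : Matrix (Fin 2) (Fin 2) ℂ) * C - (C : Matrix (Fin 2) (Fin 2) ℂ) * A =
      (τ / 2 * δ) • (I * J - J * I) := by
    rw [hA, hC]
    simp only [smul_mul_smul_comm, mul_add, add_mul, mul_one, one_mul]
    module
  rw [gamma_proj, slGamma_eq_neg_det, this, Matrix.det_smul, det_commutator hI hJ hII hJJ,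
    Fintype.card_fin]
  generalize (I * J).trace / 2 = t at *
  linear_combination -(1 + t) * hδ - δ ^ 2 * (1 - t ^ 2) * hτ

theorem isDiscrete_closure {f g Φ : PSL(2, ℂ)} (h : IsDiscrete (Subgroup.closure {f, g}))
    (hΦ : orderOf Φ = 2) (hconj : Φ * f * Φ⁻¹ = g) : IsDiscrete (Subgroup.closure {f, Φ}) := by
  have hfin : IsOfFinOrder Φ := orderOf_pos_iff.1 (by rw [hΦ]; norm_num)
  have hsq : Φ * Φ = 1 := by rw [← pow_two]; exact orderOf_dvd_iff_pow_eq_one.1 hΦ.dvd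
  have hf : f ∈ Subgroup.closure {f, g} := Subgroup.subset_closure (by simp)
  have hg : g ∈ Subgroup.closure {f, g} := Subgroup.subset_closure (by simp)
  have hnorm : Φ ∈ Subgroup.normalizer (Subgroup.closure {f, g} : Set PSL(2, ℂ)) := by
    refine Subgroup.mem_normalizer_of_isOfFinOrder hfin ?_
    have : Subgroup.closure {f, g} ≤
        (Subgroup.closure {f, g}).comap (MulAut.conj Φ).toMonoidHom := by
      rw [Subgroup.closure_le]
      rintro x (rfl | rfl)
      · simpa [hconj] using hg
      · have : Φ * (Φ * f * Φ⁻¹) * Φ⁻¹ = f := by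
          rw [show Φ * (Φ * f * Φ⁻¹) * Φ⁻¹ = (Φ * Φ) * f * (Φ * Φ)⁻¹ by group, hsq]
          simp
        rw [hconj] at this
        simpa [this] using hf
    exact fun y hy => this hy
  refine (h.sup_zpowers hfin hnorm).of_le ?_
  rw [Subgroup.closure_le]
  rintro x (rfl | rfl)
  · exact Subgroup.mem_sup_left hf
  · exact Subgroup.mem_sup_right (Subgroup.mem_zpowers _)

/-- A group `P` which is normalised by `f` and `Φ`, where `Φ` conjugates `f` into `f⁻¹ P`, has finite
index in the group generated by `P`, `f` and `Φ`. -/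
theorem commensurable_sup_zpowers {G : Type*} [Group G] {P : Subgroup G} {f g Φ : G}
    (hf : IsOfFinOrder f) (hΦ : IsOfFinOrder Φ) (hfP : f ∈ Subgroup.normalizer (P : Set G))
    (hΦP : Φ ∈ Subgroup.normalizer (P : Set G)) (hconj : Φ * f * Φ⁻¹ = g) (hfg : f * g ∈ P) :
    Subgroup.Commensurable (P ⊔ Subgroup.zpowers f ⊔ Subgroup.zpowers Φ) P := by
  have hg : g ∈ P ⊔ Subgroup.zpowers f := by
    rw [show g = f⁻¹ * (f * g) by group]
    exact mul_mem (inv_mem (Subgroup.mem_sup_right (Subgroup.mem_zpowers f)))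
      (Subgroup.mem_sup_left hfg)
  have hnorm : Φ ∈ Subgroup.normalizer ((P ⊔ Subgroup.zpowers f : Subgroup G) : Set G) := by
    refine Subgroup.mem_normalizer_of_isOfFinOrder hΦ ?_
    have : P ⊔ Subgroup.zpowers f ≤
        (P ⊔ Subgroup.zpowers f).comap (MulAut.conj Φ).toMonoidHom := by
      rw [sup_le_iff, Subgroup.zpowers_le]
      constructor
      · intro y hy
        exact Subgroup.mem_sup_left ((Subgroup.mem_normalizer_iff.1 hΦP y).1 hy)
      · simpa [hconj] using hg
    exact fun y hy => this hy
  constructor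
  · rw [Subgroup.relIndex_eq_one.2 (le_sup_left.trans le_sup_left)]
    exact one_ne_zero
  · exact Subgroup.relIndex_ne_zero_trans (Subgroup.relIndex_sup_zpowers_ne_zero hf hfP)
      (Subgroup.relIndex_sup_zpowers_ne_zero hΦ hnorm)

theorem exists_isArithmeticKleinian (hfA : IsOfFinOrder (proj A)) (hfC : IsOfFinOrder (proj C))
    (harith : ∃ Γ : Subgroup PSL(2, ℂ),
      IsArithmeticKleinian Γ ∧ Subgroup.closure {proj A, proj B} ≤ Γ)
    (hτ : τ ^ 2 = 2) (hτ' : τ' ^ 2 = 2) (hI : I.trace = 0) (hJ : J.trace = 0)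
    (hII : I * I = -1) (hJJ : J * J = -1)
    (hA : (A : Matrix (Fin 2) (Fin 2) ℂ) = (τ / 2) • (1 + I))
    (hB : (B : Matrix (Fin 2) (Fin 2) ℂ) = (τ' / 2) • (1 + J))
    (hC : (C : Matrix (Fin 2) (Fin 2) ℂ) = δ • (I + J))
    (him : (((I * J).trace / 2) ^ 2).im ≠ 0) :
    ∃ Γ : Subgroup PSL(2, ℂ), IsArithmeticKleinian Γ ∧ Subgroup.closure {proj A, proj C} ≤ Γ := by
  obtain ⟨Γ, ⟨k, _, _, a, b, σ, ρ, O, hk, ha, hb, hram, hσ, hρ, hO, hcomm⟩, hle⟩ := harith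
  -- Without normality the exponent may vary with the element but is bounded by the index, so the
  -- factorial of the index works for all.
  obtain ⟨n, hn, hpow⟩ : ∃ n : ℕ, n ≠ 0 ∧ ∀ y ∈ Subgroup.closure {proj A, proj B},
      y ^ n ∈ (normOneImage O ρ).map proj :=
    ⟨_, Nat.factorial_ne_zero _, fun y hy => (Subgroup.pow_mem_of_relIndex_ne_zero_of_dvd hcomm.2
      (hle hy) fun m h1 h2 => Nat.dvd_factorial h1 h2).1⟩
  have hpow' := hpow
  rw [Set.pair_comm] at hpow'
  obtain ⟨i, rfl⟩ := exists_map_eq_of_pow_mem ha hb hρ hn hpow hτ hτ' hI hJ hII hJJ hA hB him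
  obtain ⟨j, rfl⟩ := exists_map_eq_of_pow_mem ha hb hρ hn hpow' hτ' hτ hJ hI hJJ hII hB hA
    (by rwa [Matrix.trace_mul_comm])
  have hint := isIntegral_trace_mul_div_two hO hn (hpow _ (mul_mem
    (Subgroup.subset_closure (by simp)) (Subgroup.subset_closure (by simp)))) hτ hτ' hI hJ hA hB
  have hJI := mul_comm_of_trace_eq_zero hI hJ
  have htr : (ρ i * ρ j).trace / 2 = σ (i * j).re := by
    rw [← map_mul, trace_map ha hb hρ]
    ring
  rw [htr] at hint hJI him
  obtain ⟨t, ht⟩ : ∃ t : 𝓞 k, (t : k) = (i * j).re :=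
    ⟨⟨(i * j).re, (isIntegral_algHom_iff σ.toIntAlgHom σ.injective).1 hint⟩, rfl⟩
  rw [← ht] at hJI him
  have hinj := map_injective ha hb hρ
  have hii : i * i = -1 := hinj (by rw [map_mul, hII, map_neg, map_one])
  have hjj : j * j = -1 := hinj (by rw [map_mul, hJJ, map_neg, map_one])
  have hji : j * i = (2 * (t : k)) • 1 - i * j := hinj (by
    rw [map_mul, hJI, map_sub, map_smul hρ, map_one, map_mul, map_mul, map_ofNat])
  have hre : ∀ x, (ρ x).trace = 0 → x.re = 0 := fun x hx => by
    rw [trace_map ha hb hρ] at hx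
    exact (map_eq_zero σ).1 ((mul_eq_zero.1 hx).resolve_left two_ne_zero)
  have hi := hre i hI
  have hj := hre j hJ
  have ht1 : (t : k) ^ 2 ≠ 1 := fun h => him (by rw [← map_pow, h, map_one, Complex.one_im])
  have ht1' : 2 * (t : k) - 2 ≠ 0 := fun h =>
    ht1 (by rw [show (t : k) = 1 by linear_combination h / 2, one_pow])
  have hmem : ∀ M : SL(2, ℂ), M ∈ normOneImage (combOrder hii hjj hji) ρ ↔
      ∃ x ∈ combOrder hii hjj hji, ρ x = (M : Matrix (Fin 2) (Fin 2) ℂ) :=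
    fun M => mem_normOneImage_combOrder ha hb hρ hii hjj hji hi hj
  have hnA : proj A ∈ Subgroup.normalizer
      ((normOneImage (combOrder hii hjj hji) ρ).map proj : Set PSL(2, ℂ)) := by
    refine proj_mem_normalizer hmem hfA ?_
    rintro _ ⟨p, q, r, s, rfl⟩
    refine ⟨_, ⟨p - r * (1 + t), q - r * (1 + t) - s * t, -r - s, s + 2 * r, rfl⟩, ?_⟩
    have h := one_add_mul_comb_mul hii hji (p : k) q r s
    have h2 : (1 - i) * (1 + i) = (2 : k) • 1 := by
      simp only [sub_mul, mul_add, one_mul, mul_one, hii]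
      module
    have h3 := congr_arg (fun x => (2 : k)⁻¹ • (x * (1 + i))) h
    simp only [mul_assoc _ (1 - i), h2, mul_smul_comm, smul_mul_assoc, mul_one] at h3
    rw [inv_smul_smul₀ two_ne_zero, inv_smul_smul₀ two_ne_zero] at h3
    have h4 := congr_arg ρ h3
    rw [map_mul, map_mul, map_add, map_one] at h4
    rw [hA, smul_mul_assoc, mul_smul_comm, h4]
    push_cast
    rfl
  have hnC : proj C ∈ Subgroup.normalizer
      ((normOneImage (combOrder hii hjj hji) ρ).map proj : Set PSL(2, ℂ)) := by
    refine proj_mem_normalizer hmem hfC ?_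
    rintro _ ⟨p, q, r, s, rfl⟩
    refine ⟨_, ⟨p + s * (t + 1), r + s, q + s, -s, rfl⟩, ?_⟩
    have h := add_mul_comb_mul hii hjj hji (p : k) q r s
    have h2 : (i + j) * (i + j) = (2 * (t : k) - 2) • 1 := by
      simp only [add_mul, mul_add, hii, hjj, hji]
      module
    have h3 := congr_arg (fun x => (2 * (t : k) - 2)⁻¹ • (x * (i + j))) h
    simp only [mul_assoc _ (i + j) (i + j), h2, mul_smul_comm, smul_mul_assoc, mul_one] at h3
    rw [inv_smul_smul₀ ht1', inv_smul_smul₀ ht1'] at h3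
    have h4 := congr_arg ρ h3
    rw [map_mul, map_mul, map_add] at h4
    rw [hC, smul_mul_assoc, mul_smul_comm, h4]
    push_cast
    rfl
  -- The fourth basis element is chosen for this: `AB = ±(1 + i)(1 + j)/2`.
  have hAB : proj A * proj B ∈ (normOneImage (combOrder hii hjj hji) ρ).map proj := by
    refine ⟨A * B, (hmem _).2 ?_, map_mul _ _ _⟩
    have h : ρ (comb i j (0 : k) 0 0 1) = (1 / 2 : ℂ) • ((1 + ρ i) * (1 + ρ j)) := by
      have : comb i j (0 : k) 0 0 1 = (1 / 2 : k) • ((1 + i) * (1 + j)) := by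
        simp only [comb, mul_add, add_mul, mul_one, one_mul]
        module
      rw [this, map_smul hρ, map_mul, map_add, map_add, map_one, map_div₀, map_one, map_ofNat]
    have h0 : comb i j (0 : k) 0 0 1 ∈ combOrder hii hjj hji := ⟨0, 0, 0, 1, by simp⟩
    have hc : τ / 2 * (τ' / 2) = τ * τ' / 2 * (1 / 2) := by ring
    rw [Matrix.SpecialLinearGroup.coe_mul, hA, hB, smul_mul_smul_comm, hc, mul_smul, ← h]
    rcases mul_div_two_eq_one_or hτ hτ' with h1 | h1 <;> rw [h1]
    · exact ⟨_, h0, (one_smul _ _).symm⟩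
    · exact ⟨_, neg_mem h0, by rw [map_neg, neg_one_smul]⟩
  have hconj := conj_eq hτ hτ' hII hJJ hA hB hC
  refine ⟨_, ⟨k, _, _, a, b, σ, ρ, combOrder hii hjj hji, hk, ha, hb, hram, hσ, hρ,
    isOrder_combOrder hii hjj hji hi hj ht1,
    commensurable_sup_zpowers hfA hfC hnA hnC hconj hAB⟩, ?_⟩
  rw [Subgroup.closure_le]
  rintro x (rfl | rfl)
  · exact Subgroup.mem_sup_left (Subgroup.mem_sup_right (Subgroup.mem_zpowers _))
  · exact Subgroup.mem_sup_right (Subgroup.mem_zpowers _)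

/-- The involution `I + J` has all the required properties for the root `-1 - tr(I J) / 2`. -/
theorem exists_involution (hfA : IsOfFinOrder (proj A))
    (hdisc : IsDiscrete (Subgroup.closure {proj A, proj B}))
    (harith : ∃ Γ : Subgroup PSL(2, ℂ),
      IsArithmeticKleinian Γ ∧ Subgroup.closure {proj A, proj B} ≤ Γ)
    (hτ : τ ^ 2 = 2) (hτ' : τ' ^ 2 = 2) (hI : I.trace = 0) (hJ : J.trace = 0)
    (hII : I * I = -1) (hJJ : J * J = -1)
    (hA : (A : Matrix (Fin 2) (Fin 2) ℂ) = (τ / 2) • (1 + I))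
    (hB : (B : Matrix (Fin 2) (Fin 2) ℂ) = (τ' / 2) • (1 + J))
    (him : (((I * J).trace / 2) ^ 2).im ≠ 0) :
    ∃ Φ : PSL(2, ℂ), orderOf Φ = 2 ∧ Φ * proj A * Φ⁻¹ = proj B ∧
      gamma (proj A) Φ = -1 - (I * J).trace / 2 ∧
      IsDiscrete (Subgroup.closure {proj A, Φ}) ∧
      ∃ Γ : Subgroup PSL(2, ℂ),
        IsArithmeticKleinian Γ ∧ Subgroup.closure {proj A, Φ} ≤ Γ := by
  have hJI := mul_comm_of_trace_eq_zero hI hJ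
  obtain ⟨δ, C, hδ, hC⟩ := exists_specialLinearGroup_eq_smul_add hI hJ hII hJJ hJI
    (fun h => him (by rw [h, one_pow, Complex.one_im]))
  have hord := orderOf_proj_eq_two hII hJJ hJI hδ hC
  have hconj := conj_eq hτ hτ' hII hJJ hA hB hC
  exact ⟨proj C, hord, hconj, gamma_proj_eq hτ hI hJ hII hJJ hδ hA hC,
    isDiscrete_closure hdisc hord hconj,
    exists_isArithmeticKleinian hfA (orderOf_pos_iff.1 (by rw [hord]; norm_num)) harith hτ hτ' hI
      hJ hII hJJ hA hB hC him⟩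

end Core

end Kleinian

theorem mainTheorem11 (f g : PSL(2, ℂ)) (hf : orderOf f = 4) (hg : orderOf g = 4)
    (hdisc : Kleinian.IsDiscrete (Subgroup.closure {f, g}))
    (harith : ∃ Γ : Subgroup PSL(2, ℂ),
      Kleinian.IsArithmeticKleinian Γ ∧ Subgroup.closure {f, g} ≤ Γ)
    (hγ : (Kleinian.gamma f g).im ≠ 0)
    (γ' : ℂ) (hγ' : γ' * (γ' + 2) = Kleinian.gamma f g) :
    ∃ Φ : PSL(2, ℂ), orderOf Φ = 2 ∧
      (Φ * f * Φ⁻¹ = g ∨ Φ * f * Φ⁻¹ = g⁻¹) ∧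
      Kleinian.gamma f Φ = γ' ∧
      Kleinian.IsDiscrete (Subgroup.closure {f, Φ}) ∧
      ∃ Γ : Subgroup PSL(2, ℂ),
        Kleinian.IsArithmeticKleinian Γ ∧ Subgroup.closure {f, Φ} ≤ Γ := by
  obtain ⟨A, rfl⟩ := Kleinian.proj_surjective f
  obtain ⟨B, rfl⟩ := Kleinian.proj_surjective g
  obtain ⟨τ, I, hτ, hII, hI, hA⟩ := Kleinian.exists_sqrt_neg_one A hf
  obtain ⟨τ', J, hτ', hJJ, hJ, hB⟩ := Kleinian.exists_sqrt_neg_one B hg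
  have hfA : IsOfFinOrder (Kleinian.proj A) := orderOf_pos_iff.1 (by rw [hf]; norm_num)
  have hgamma : Kleinian.gamma (Kleinian.proj A) (Kleinian.proj B) =
      ((I * J).trace / 2) ^ 2 - 1 := Kleinian.slGamma_eq hτ hτ' hI hJ hII hJJ hA hB
  rw [hgamma] at hγ hγ'
  have him : (((I * J).trace / 2) ^ 2).im ≠ 0 := by simpa using hγ
  have hroot : (γ' + 1) ^ 2 = ((I * J).trace / 2) ^ 2 := by linear_combination hγ'
  -- The involution `I + J` realises `γ' = -1 - t`; the case `γ' = -1 + t` is reached by passing to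
  -- `g⁻¹`, whose lift has `-J` in place of `J`.
  rcases sq_eq_sq_iff_eq_or_eq_neg.1 hroot with h | h
  · have hcl : Subgroup.closure {Kleinian.proj A, Kleinian.proj B⁻¹} =
        Subgroup.closure {Kleinian.proj A, Kleinian.proj B} := by
      apply le_antisymm <;> rw [Subgroup.closure_le] <;> rintro x (rfl | rfl)
      · exact Subgroup.subset_closure (by simp)
      · rw [map_inv]
        exact inv_mem (Subgroup.subset_closure (by simp))
      · exact Subgroup.subset_closure (by simp)
      · rw [← inv_inv (Kleinian.proj B), ← map_inv]
        exact inv_mem (Subgroup.subset_closure (by simp))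
    have hJ' : (-J).trace = 0 := by rw [Matrix.trace_neg, hJ, neg_zero]
    have hJJ' : -J * -J = -1 := by rw [neg_mul_neg, hJJ]
    have hB' := Kleinian.coe_inv_eq hJ hB
    rw [sub_eq_add_neg] at hB'
    have htr : (I * -J).trace / 2 = -((I * J).trace / 2) := by
      rw [mul_neg, Matrix.trace_neg, neg_div]
    obtain ⟨Φ, h1, h2, h3, h4, h5⟩ := Kleinian.exists_involution hfA (by rwa [hcl])
      (by rwa [hcl]) hτ hτ' hI hJ' hII hJJ' hA hB' (by rwa [htr, neg_sq])
    exact ⟨Φ, h1, .inr (by rw [h2, map_inv]), by rw [h3, htr]; linear_combination -h, h4, h5⟩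
  · obtain ⟨Φ, h1, h2, h3, h4, h5⟩ := Kleinian.exists_involution hfA hdisc harith hτ hτ' hI hJ hII
      hJJ hA hB him
    exact ⟨Φ, h1, .inl h2, by rw [h3]; linear_combination -h, h4, h5⟩
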